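/- Let $K\subset\mathbb C$ be a field, $f_1,\dots,f_N\in K[x_1,\dots,x_n]$, and let $\xi\in\mathbb C^n$ be an isolated root of $f=(f_1,\dots,f_N)$. Let $I=(f_1,\dots,f_N)\subset\mathbb C[x]$, let $Q$ be the primary component of $I$ at $\xi$, and let $\delta=\dim_{\mathbb C}\mathbb C[x]/Q$. For $\Lambda=\sum_\beta c_\beta\partial_\xi^\beta\in\mathbb C[\partial_\xi]$ put $\Lambda(p)=\sum_\beta c_\beta\,(\partial^\beta p)(\xi)$, let $\operatorname{ord}\Lambda$ be the degree of $\Lambda$ in the $\partial$'s, let $\mathscr D=\{\Lambda\in\mathbb C[\partial_\xi] : \Lambda(p)=0\ \forall p\in I\}$, and let $\mathscr D_t$ be the set of elements of $\mathscr D$ of order at most $t$. Fix a primal basis $B=\{(x-\xi)^{\alpha_0},\dots,(x-\xi)^{\alpha_{\delta-1}}\}$ of $\mathbb C[x]/Q$, with $\alpha_0=0$ and connected to $1$ (every $\alpha_k\neq0$ is of the form $\alpha_l+e_i$), and a dual basis $\Lambda_0,\dots,\Lambda_{\delta-1}\in\mathscr D$ with $\Lambda_i((x-\xi)^{\alpha_j})=\delta_{ij}$,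 $0=\operatorname{ord}\Lambda_0\le\dots\le\operatorname{ord}\Lambda_{\delta-1}$, and $\mathscr D_t=\operatorname{span}\{\Lambda_j:\operatorname{ord}\Lambda_j\le t\}$ for all $t$. Let $E=\{\alpha_0,\dots,\alpha_{\delta-1}\}$. Take one variable $\mu_{\alpha_i,\beta}$ for each pair $(\alpha_i,\beta)$ such that $\beta\notin E$ and $\beta=\alpha_k+e_j$ for some $k<i$ and some $j$, and put $\nu_{\alpha_i,\beta}=\Lambda_i((x-\xi)^\beta)$. For $j=1,\dots,n$ let $M_j(\mu)$ be the strictly lower triangular $\delta\times\delta$ matrix (indices $0,\dots,\delta-1$) whose entry in row $i$ and column $k<i$ is $1$ if $\alpha_k+e_j=\alpha_i$, is $0$ if $\alpha_k+e_j\in E\setminus\{\alpha_i\}$, and is $\mu_{\alpha_i,\alpha_k+e_j}$ if $\alpha_k+e_j\notin E$. Let $M(\mu)^\gamma=M_1(\mu)^{\gamma_1}\cdots M_n(\mu)^{\gamma_n}$, let $[1]=(1,0,\dots,0)^t$, and define $$\mathcal N_{z,\mu}(p)=\sum_{\gamma\in\mathbb N^n}\frac1{\gamma!}\,(\partial^\gamma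 p)(z)\,M(\mu)^\gamma[1].$$ Theorem. The point $(z,\mu)=(\xi,\nu)$ is an isolated root with multiplicity one of the polynomial system in $K[z,\mu]$ $$\mathcal N_{z,\mu}(f_k)=0\ (1\le k\le N),\qquad M_i(\mu)M_j(\mu)-M_j(\mu)M_i(\mu)=0\ (1\le i,j\le n),$$ and the Jacobian matrix of this system at $(\xi,\nu)$ has trivial kernel. Moreover $(\xi,\nu)$ encodes the dual basis: $\mathcal N_{\xi,\nu}(p)=(\Lambda_0(p),\dots,\Lambda_{\delta-1}(p))^t$ for every $p\in\mathbb C[x]$. -/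

import Mathlib

open MvPolynomial Topology Filter

namespace MultStructure

noncomputable section

/-! ### Polynomial systems, isolated roots, multiplicity, Jacobian -/

/-- `x` is an isolated root of the system `P` (coefficients in `K`, points in `ℂ^σ`): it is a root,
and a punctured neighbourhood of `x` contains no root. -/
def IsIsolatedRoot {K σ ι : Type*} [Field K] [Algebra K ℂ]
    (P : ι → MvPolynomial σ K) (x : σ → ℂ) : Prop :=
  (∀ k, aeval x (P k) = 0) ∧ ∀ᶠ y in 𝓝[≠] x, ∃ k, aeval y (P k) ≠ 0

/-- The ideal of `ℂ[σ]` generated by a system with coefficients in `K`. -/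
def systemIdeal {K σ ι : Type*} [Field K] [Algebra K ℂ] (P : ι → MvPolynomial σ K) :
    Ideal (MvPolynomial σ ℂ) :=
  Ideal.span (Set.range fun k => MvPolynomial.map (algebraMap K ℂ) (P k))

/-- The component of `I` at the point `x`: the contraction to `ℂ[σ]` of the extension of `I` to the
local ring at `x`. If `x` is an isolated zero of `I`, this is the primary component of `I` whose
radical is the maximal ideal of `x`. -/
def primaryComponentAt {σ : Type*} (I : Ideal (MvPolynomial σ ℂ)) (x : σ → ℂ) :
    Ideal (MvPolynomial σ ℂ) where
  carrier := {q | ∃ p, eval x p ≠ 0 ∧ p * q ∈ I}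
  zero_mem' := ⟨1, by simp, by simp⟩
  add_mem' := by
    rintro a b ⟨p, hp, hpa⟩ ⟨q, hq, hqb⟩
    refine ⟨p * q, by simp [hp, hq], ?_⟩
    have h : p * q * (a + b) = q * (p * a) + p * (q * b) := by ring
    rw [h]
    exact I.add_mem (I.mul_mem_left _ hpa) (I.mul_mem_left _ hqb)
  smul_mem' := by
    rintro c a ⟨p, hp, hpa⟩
    refine ⟨p, hp, ?_⟩
    have h : p * (c • a) = c * (p * a) := by simp only [smul_eq_mul]; ring
    rw [h]
    exact I.mul_mem_left _ hpa

/-- The multiplicity of the system `P` at `x`: the dimension of `ℂ[σ] / Q`, where `Q` is the primary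
component at `x` of the ideal generated by `P`. -/
def multiplicityAt {K σ ι : Type*} [Field K] [Algebra K ℂ]
    (P : ι → MvPolynomial σ K) (x : σ → ℂ) : ℕ :=
  Module.finrank ℂ (MvPolynomial σ ℂ ⧸ primaryComponentAt (systemIdeal P) x)

/-- The Jacobian matrix of the system `P` at `x`. -/
def jacobianAt {K σ ι : Type*} [Field K] [Algebra K ℂ]
    (P : ι → MvPolynomial σ K) (x : σ → ℂ) : Matrix ι σ ℂ :=
  Matrix.of fun k s => aeval x (pderiv s (P k))

/-! ### Differential functionals at a point and the inverse system -/

/-- `∂^γ = ∂₁^γ₁ ⋯ ∂ₙ^γₙ`, acting on polynomials. -/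
def iterPDeriv {R : Type*} [CommRing R] {n : ℕ} (γ : Fin n →₀ ℕ) :
    Module.End R (MvPolynomial (Fin n) R) :=
  (List.ofFn fun i => (pderiv (R := R) i).toLinearMap ^ γ i).prod

/-- The value `L(p)` of a differential functional `L = ∑ c_β ∂_ξ^β ∈ ℂ[∂_ξ]` on a polynomial `p`,
where `∂_ξ^β(p) = ∂^β(p)(ξ)`. The algebra `ℂ[∂_ξ]` is the polynomial ring in `n` variables. -/
def applyAt {n : ℕ} (ξ : Fin n → ℂ) (L p : MvPolynomial (Fin n) ℂ) : ℂ :=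
  ∑ β ∈ L.support, coeff β L * eval ξ (iterPDeriv β p)

theorem applyAt_eq_sum {n : ℕ} (ξ : Fin n → ℂ) (L p : MvPolynomial (Fin n) ℂ)
    {S : Finset (Fin n →₀ ℕ)} (hS : L.support ⊆ S) :
    applyAt ξ L p = ∑ β ∈ S, coeff β L * eval ξ (iterPDeriv β p) := by
  refine Finset.sum_subset hS fun β _ hβ => ?_
  rw [notMem_support_iff.mp hβ, zero_mul]

/-- The inverse system `𝒟 = I^⊥ ∩ ℂ[∂_ξ]` of `I` at `ξ`. -/
def inverseSystem {n : ℕ} (I : Ideal (MvPolynomial (Fin n) ℂ)) (ξ : Fin n → ℂ) :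
    Submodule ℂ (MvPolynomial (Fin n) ℂ) where
  carrier := {L | ∀ p ∈ I, applyAt ξ L p = 0}
  zero_mem' := fun p _ => by simp [applyAt]
  add_mem' := by
    classical
    intro a b ha hb p hp
    have h1 := applyAt_eq_sum ξ a p (S := a.support ∪ b.support) Finset.subset_union_left
    have h2 := applyAt_eq_sum ξ b p (S := a.support ∪ b.support) Finset.subset_union_right
    rw [ha p hp] at h1
    rw [hb p hp] at h2
    rw [applyAt_eq_sum ξ (a + b) p (S := a.support ∪ b.support) support_add]
    simp only [coeff_add, add_mul, Finset.sum_add_distrib]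
    rw [← h1, ← h2, add_zero]
  smul_mem' := by
    intro c a ha p hp
    rw [applyAt_eq_sum ξ (c • a) p (S := a.support) support_smul]
    simp only [coeff_smul, smul_eq_mul, mul_assoc, ← Finset.mul_sum]
    have h := ha p hp
    unfold applyAt at h
    rw [h, mul_zero]

/-- The shifted monomial `(x - ξ)^β`. -/
def shiftedMonomial {n : ℕ} (ξ : Fin n → ℂ) (β : Fin n →₀ ℕ) : MvPolynomial (Fin n) ℂ :=
  ∏ i, (X i - C (ξ i)) ^ β i

/-- `α` lists the exponents of a primal basis `B = {(x - ξ)^{α_i}}` of `ℂ[x] / Q`, where `Q` is the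
primary component of `I` at `ξ`, and `Λ` is the dual basis of the inverse system orthogonal to it.
The order of a functional is its total degree in the `∂`'s. -/
structure IsPrimalDualPair {n δ : ℕ} [NeZero δ] (I : Ideal (MvPolynomial (Fin n) ℂ))
    (ξ : Fin n → ℂ) (α : Fin δ → Fin n →₀ ℕ) (Λ : Fin δ → MvPolynomial (Fin n) ℂ) : Prop where
  /-- the first element of `B` is `1` -/
  exponent_zero : α 0 = 0
  /-- `B` is connected to `1` -/
  connected : ∀ k, α k ≠ 0 → ∃ l i, α k = α l + Finsupp.single i 1
  /-- `B` is linearly independent modulo `Q` -/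
  linearIndependent : LinearIndependent ℂ fun i =>
    Ideal.Quotient.mk (primaryComponentAt I ξ) (shiftedMonomial ξ (α i))
  /-- `B` spans `ℂ[x] / Q` -/
  span_eq_top : Submodule.span ℂ (Set.range fun i =>
    Ideal.Quotient.mk (primaryComponentAt I ξ) (shiftedMonomial ξ (α i))) = ⊤
  /-- the `Λ_i` belong to the inverse system -/
  mem_inverseSystem : ∀ i, Λ i ∈ inverseSystem I ξ
  /-- `Λ_i((x - ξ)^{α_j})` is `1` if `i = j` and `0` otherwise; equivalently, `Λ_i` is the sum of
  `(1/α_i!) ∂^{α_i}` and of multiples of `∂^β` with `β ∉ E` -/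
  orthogonal : ∀ i j, applyAt ξ (Λ i) (shiftedMonomial ξ (α j)) = if i = j then 1 else 0
  /-- the orders of the `Λ_i` do not decrease -/
  monotone_order : Monotone fun i => (Λ i).totalDegree
  /-- the elements of order `≤ t` of the inverse system are spanned by the `Λ_j` of order `≤ t` -/
  filtration : ∀ t : ℕ, inverseSystem I ξ ⊓ restrictTotalDegree (Fin n) ℂ t =
    Submodule.span ℂ {L | ∃ j, L = Λ j ∧ (Λ j).totalDegree ≤ t}

/-! ### Parametric multiplication matrices and the parametric normal form -/

/-- The parameters `μ_{α_i, β}`: pairs `(i, β)` such that `β = α_k + e_j ∉ E` for some `k < i` and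
some `j`. They are the parameters occurring strictly above the diagonals of the `Mⱼᵗ(μ)`. -/
def Param {n δ : ℕ} (α : Fin δ → Fin n →₀ ℕ) : Type :=
  {v : Fin δ × (Fin n →₀ ℕ) //
    v.2 ∉ Set.range α ∧ ∃ k < v.1, ∃ j, v.2 = α k + Finsupp.single j 1}

instance {n δ : ℕ} (α : Fin δ → Fin n →₀ ℕ) : Finite (Param α) := by
  have h : Set.Finite {v : Fin δ × (Fin n →₀ ℕ) |
      v.2 ∉ Set.range α ∧ ∃ k < v.1, ∃ j, v.2 = α k + Finsupp.single j 1} := by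
    refine (Set.finite_range fun t : Fin δ × Fin δ × Fin n =>
      (t.1, α t.2.1 + Finsupp.single t.2.2 1)).subset ?_
    rintro ⟨i, β⟩ ⟨-, k, -, j, h⟩
    exact ⟨(i, k, j), by simpa using h.symm⟩
  exact h.to_subtype

instance {n δ : ℕ} (α : Fin δ → Fin n →₀ ℕ) : Fintype (Param α) := Fintype.ofFinite _

open Classical in
/-- The parametric multiplication matrix `M_j(μ)`, with entries in `K[z, μ]`. It is strictly lower
triangular, and for `k < i` its entry in row `i` and column `k` is `1` if `α_k + e_j = α_i`, it is `0`
if `α_k + e_j` is another element of `E`, and it is the variable `μ_{α_i, α_k + e_j}` otherwise. -/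
def paramMatrix (K : Type*) [Field K] {n δ : ℕ} (α : Fin δ → Fin n →₀ ℕ) (j : Fin n) :
    Matrix (Fin δ) (Fin δ) (MvPolynomial (Fin n ⊕ Param α) K) :=
  Matrix.of fun i k =>
    if hki : k < i then
      if α i = α k + Finsupp.single j 1 then 1
      else if hE : α k + Finsupp.single j 1 ∈ Set.range α then 0
      else X (Sum.inr ⟨(i, α k + Finsupp.single j 1), hE, k, hki, j, rfl⟩)
    else 0

/-- `M(μ)^γ = M₁(μ)^γ₁ ⋯ Mₙ(μ)^γₙ`, the factors being taken in this order. -/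
def paramMatrixPow (K : Type*) [Field K] {n δ : ℕ} (α : Fin δ → Fin n →₀ ℕ) (γ : Fin n →₀ ℕ) :
    Matrix (Fin δ) (Fin δ) (MvPolynomial (Fin n ⊕ Param α) K) :=
  (List.ofFn fun j => paramMatrix K α j ^ γ j).prod

/-- The parametric normal form `𝒩_{z,μ}(p) = ∑_γ (1/γ!) ∂_z^γ(p) M(μ)^γ [1] ∈ K[z, μ]^δ`, where
`[1] = (1, 0, …, 0)`. Only finitely many terms are nonzero, as `∂^γ(p) = 0` for large `γ`. -/
def paramNormalForm {K : Type*} [Field K] {n δ : ℕ} [NeZero δ] (α : Fin δ → Fin n →₀ ℕ)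
    (p : MvPolynomial (Fin n) K) : Fin δ → MvPolynomial (Fin n ⊕ Param α) K :=
  ∑ᶠ γ : Fin n →₀ ℕ,
    (C ((∏ i, ((γ i).factorial : K))⁻¹) * rename Sum.inl (iterPDeriv γ p) :
        MvPolynomial (Fin n ⊕ Param α) K) •
      (paramMatrixPow K α γ).mulVec (Pi.single 0 1)

/-- The deflated system in `K[z, μ]`: the entries of the `𝒩_{z,μ}(f_k)` and of the commutators
`M_i(μ) M_j(μ) - M_j(μ) M_i(μ)`. -/
def deflatedSystem {K : Type*} [Field K] {n N δ : ℕ} [NeZero δ] (α : Fin δ → Fin n →₀ ℕ)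
    (f : Fin N → MvPolynomial (Fin n) K) :
    (Fin N × Fin δ) ⊕ ((Fin n × Fin n) × (Fin δ × Fin δ)) →
      MvPolynomial (Fin n ⊕ Param α) K :=
  Sum.elim (fun e => paramNormalForm α (f e.1) e.2)
    (fun e => (paramMatrix K α e.1.1 * paramMatrix K α e.1.2 -
      paramMatrix K α e.1.2 * paramMatrix K α e.1.1) e.2.1 e.2.2)

/-- The values `ν_{α_i, β} = Λ_i((x - ξ)^β)` of the parameters: the coefficient of `(1/β!) ∂_ξ^β`
in the dual basis element `Λ_i`. -/
def dualParam {n δ : ℕ} (ξ : Fin n → ℂ) (α : Fin δ → Fin n →₀ ℕ)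
    (Λ : Fin δ → MvPolynomial (Fin n) ℂ) : Param α → ℂ :=
  fun v => applyAt ξ (Λ v.1.1) (shiftedMonomial ξ v.1.2)

/-! ### The sum defining the parametric normal form is finite -/

theorem iterPDeriv_list_monomial {R : Type*} [CommRing R] {n : ℕ} (γ : Fin n →₀ ℕ)
    (l : List (Fin n)) (s : Fin n →₀ ℕ) (a : R) :
    ∃ b : R, ∃ t : Fin n →₀ ℕ, t ≤ s ∧
      (l.map fun i => (pderiv (R := R) i).toLinearMap ^ γ i).prod (monomial s a) = monomial t b ∧
      ((∃ i ∈ l, s i < γ i) → b = 0) := by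
  have pow_step : ∀ (i : Fin n) (m : ℕ) (s : Fin n →₀ ℕ) (a : R),
      ∃ b : R, ∃ t : Fin n →₀ ℕ, t ≤ s ∧
        ((pderiv (R := R) i).toLinearMap ^ m) (monomial s a) = monomial t b ∧
        (a = 0 → b = 0) ∧ (s i < m → b = 0) ∧ (∀ j, j ≠ i → t j = s j) := by
    intro i m
    induction m with
    | zero => exact fun s a => ⟨a, s, le_rfl, by simp, id, by simp, by simp⟩
    | succ m ih =>
      intro s a
      obtain ⟨b, t, ht, he, h0, hs, hj⟩ := ih (s - Finsupp.single i 1) (a * (s i : R))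
      refine ⟨b, t, ht.trans tsub_le_self, ?_, ?_, ?_, ?_⟩
      · rw [pow_succ, Module.End.mul_apply]
        have : (pderiv (R := R) i).toLinearMap (monomial s a) =
            monomial (s - Finsupp.single i 1) (a * (s i : R)) := pderiv_monomial
        rw [this, he]
      · intro ha; exact h0 (by simp [ha])
      · intro hsm
        by_cases hz : s i = 0
        · exact h0 (by simp [hz])
        · apply hs
          simp only [Finsupp.tsub_apply, Finsupp.single_eq_same]
          omega
      · intro j hji
        rw [hj j hji]
        simp [Finsupp.single_eq_of_ne hji]
  induction l with
  | nil => exact ⟨a, s, le_rfl, by simp, by simp⟩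
  | cons i l ih =>
    obtain ⟨b, t, ht, he, hb⟩ := ih
    obtain ⟨b', t', ht', he', h0, hs, -⟩ := pow_step i (γ i) t b
    refine ⟨b', t', ht'.trans ht, ?_, ?_⟩
    · rw [List.map_cons, List.prod_cons, Module.End.mul_apply, he, he']
    · rintro ⟨j, hj, hlt⟩
      rcases List.mem_cons.mp hj with rfl | hj
      · exact hs ((ht j).trans_lt hlt)
      · exact h0 (hb ⟨j, hj, hlt⟩)

theorem iterPDeriv_eq_zero {R : Type*} [CommRing R] {n : ℕ} (γ : Fin n →₀ ℕ)
    (p : MvPolynomial (Fin n) R) (i : Fin n) (hi : p.totalDegree < γ i) :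
    iterPDeriv γ p = 0 := by
  rw [p.as_sum, map_sum]
  refine Finset.sum_eq_zero fun s hs => ?_
  obtain ⟨b, t, -, he, hb⟩ := iterPDeriv_list_monomial γ (List.finRange n) s (coeff s p)
  have hsi : s i ≤ p.totalDegree :=
    (Finsupp.le_degree i s).trans (le_totalDegree hs)
  have hb0 := hb ⟨i, List.mem_finRange i, hsi.trans_lt hi⟩
  rw [iterPDeriv, List.ofFn_eq_map, he, hb0, monomial_zero]

theorem paramNormalForm_finite {K : Type*} [Field K] {n δ : ℕ} [NeZero δ]
    (α : Fin δ → Fin n →₀ ℕ) (p : MvPolynomial (Fin n) K) :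
    (Function.support fun γ : Fin n →₀ ℕ =>
      (C ((∏ i, ((γ i).factorial : K))⁻¹) * rename Sum.inl (iterPDeriv γ p) :
          MvPolynomial (Fin n ⊕ Param α) K) •
        (paramMatrixPow K α γ).mulVec (Pi.single 0 1)).Finite := by
  refine (Set.finite_Iic (Finsupp.equivFunOnFinite.symm fun _ : Fin n => p.totalDegree)).subset ?_
  intro γ hγ i
  by_contra hi
  refine hγ ?_
  have hi' : p.totalDegree < γ i := by simpa using hi
  simp [iterPDeriv_eq_zero γ p i hi']

end

end MultStructure

open MultStructure

namespace MultStructure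

noncomputable section

/-! ### Taylor expansion -/

/-! Everything follows from a uniqueness statement over a ring with nilpotents. Write `x = (ξ, ν)`,
and let `Q'` be the component at `x` of the ideal of the deflated system. In `R = ℂ[z, μ] / Q'`
every polynomial not vanishing at `x` becomes a nonzerodivisor, and the classes of the coordinates
form a tautological solution `y` of the system. If `y` is the constant point `x`, then every `X s -
C (x s)` lies in `Q'` (`X_sub_C_mem`). So `Q'` is the maximal ideal of `x`, and isolatedness,
multiplicity one and the trivial Jacobian kernel are then formal.

Why `y = x` (`eq_of_deflatedSystem_eq_zero`): the commutator equations give an algebra map `Φ` from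
`ℂ[x]` to matrices over `R`, sending `X_j` to `z_j + M_j(μ)`. By Taylor's formula the normal form of
`p` is `Φ(p)[1]`. The remaining equations make `Φ(p)[1]` vanish on `I`, hence on `Q`: if `p * q ∈ I`
and `p(ξ) ≠ 0`, the triangular matrix `Φ(p)` has the regular determinant `p(z)^δ`. Let `S` have
columns `Φ((x - ξ)^{α_k})[1]`, and let `D_j` be the matrix of multiplication by `x_j - ξ_j`. Then
`Φ(X_j) S = S (ξ_j + D_j)`. The determinant of `S` is regular because the same matrix at `x` is the
identity, so comparing traces gives `δ z_j = δ ξ_j`. Once `z = ξ`, connectedness to `1` forces `S =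
1`, whence `M_j(μ) = D_j` and `μ = ν`.

That `x` itself is a root comes from duality: `∂_j` lowers the order and preserves the inverse
system, so `D_j` is strictly lower triangular and equals `M_j(ν)`. The `D_j` commute because
multiplications do. -/

/-- The substitution `X_i ↦ X_i + z_i`. -/
def translate {K R : Type*} [CommRing K] [CommRing R] [Algebra K R] {n : ℕ} (z : Fin n → R) :
    MvPolynomial (Fin n) K →ₐ[K] MvPolynomial (Fin n) R :=
  aeval fun i => X i + C (z i)

@[simp]
theorem translate_X {K R : Type*} [CommRing K] [CommRing R] [Algebra K R] {n : ℕ} (z : Fin n → R)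
    (i : Fin n) : translate (K := K) z (X i) = X i + C (z i) := by
  simp [translate]

theorem pderiv_translate {K R : Type*} [CommRing K] [CommRing R] [Algebra K R] {n : ℕ}
    (z : Fin n → R) (i : Fin n) (p : MvPolynomial (Fin n) K) :
    pderiv i (translate z p) = translate z (pderiv i p) := by
  induction p using MvPolynomial.induction_on with
  | C a =>
    rw [pderiv_C, map_zero, ← algebraMap_eq, AlgHom.commutes,
      IsScalarTower.algebraMap_apply K R (MvPolynomial (Fin n) R), algebraMap_eq, pderiv_C]
  | add p q hp hq => simp [hp, hq]
  | mul_X p j hp =>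
    simp only [map_mul, translate_X, Derivation.leibniz, hp, map_add, smul_eq_mul, pderiv_C,
      add_zero, pderiv_X]
    by_cases h : j = i
    · subst h; simp
    · simp [Pi.single_eq_of_ne h]

theorem iterPDeriv_translate {K R : Type*} [CommRing K] [CommRing R] [Algebra K R] {n : ℕ}
    (z : Fin n → R) (γ : Fin n →₀ ℕ) (p : MvPolynomial (Fin n) K) :
    iterPDeriv γ (translate z p) = translate z (iterPDeriv γ p) := by
  have hpow : ∀ (i : Fin n) (m : ℕ) (q : MvPolynomial (Fin n) K),
      ((pderiv (R := R) i).toLinearMap ^ m) (translate z q) =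
        translate z (((pderiv (R := K) i).toLinearMap ^ m) q) := by
    intro i m
    induction m with
    | zero => simp
    | succ m ih =>
      intro q
      rw [pow_succ, pow_succ, Module.End.mul_apply, Module.End.mul_apply, ← ih]
      exact congrArg _ (pderiv_translate z i q)
  simp only [iterPDeriv, List.ofFn_eq_map]
  induction List.finRange n with
  | nil => simp
  | cons i l ih => simp [Module.End.mul_apply, ih, hpow]

theorem coeff_pderiv_pow {R : Type*} [CommRing R] {n : ℕ} (i : Fin n) (m : ℕ) (s : Fin n →₀ ℕ)
    (q : MvPolynomial (Fin n) R) :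
    coeff s (((pderiv (R := R) i).toLinearMap ^ m) q) =
      coeff (s + Finsupp.single i m) q * ((s i + 1).ascFactorial m : R) := by
  induction m generalizing q with
  | zero => simp
  | succ m ih =>
    rw [pow_succ, Module.End.mul_apply, ih]
    have h : (pderiv (R := R) i).toLinearMap q = pderiv i q := rfl
    rw [h, MvPolynomial.coeff_pderiv, add_assoc, ← Finsupp.single_add, mul_assoc, Nat.ascFactorial_succ]
    congr 1
    simp only [Finsupp.add_apply, Finsupp.single_eq_same]
    push_cast
    ring

theorem coeff_zero_iterPDeriv {R : Type*} [CommRing R] {n : ℕ} (γ : Fin n →₀ ℕ)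
    (q : MvPolynomial (Fin n) R) :
    coeff 0 (iterPDeriv γ q) = coeff γ q * ∏ i, ((γ i).factorial : R) := by
  -- The derivatives are peeled off one variable at a time. Requiring `s` to vanish on the variables
  -- still to come turns each rising factorial into `(γ i)!`.
  have key : ∀ (l : List (Fin n)) (_ : l.Nodup) (s : Fin n →₀ ℕ) (_ : ∀ i ∈ l, s i = 0),
      coeff s ((l.map fun i => (pderiv (R := R) i).toLinearMap ^ γ i).prod q) =
        coeff (s + (l.map fun i => Finsupp.single i (γ i)).sum) q *
          (l.map fun i => ((γ i).factorial : R)).prod := by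
    intro l
    induction l with
    | nil => simp
    | cons i l ih =>
      intro hl s hs
      obtain ⟨hil, hl⟩ := List.nodup_cons.mp hl
      rw [List.map_cons, List.prod_cons, Module.End.mul_apply, coeff_pderiv_pow, ih hl]
      · simp only [List.map_cons, List.sum_cons, List.prod_cons, hs i (by simp), add_assoc,
          zero_add, Nat.one_ascFactorial]
        ring
      · intro j hj
        have : j ≠ i := by rintro rfl; exact hil hj
        simp [hs j (by simp [hj]), Finsupp.single_eq_of_ne this]
  have h := key (List.finRange n) (List.nodup_finRange n) 0 (by simp)
  rw [iterPDeriv, List.ofFn_eq_map, h, zero_add, ← List.ofFn_eq_map, ← List.ofFn_eq_map,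
    List.sum_ofFn, List.prod_ofFn]
  congr 2
  exact Finsupp.univ_sum_single γ

theorem coeff_zero_translate {K R : Type*} [CommRing K] [CommRing R] [Algebra K R] {n : ℕ}
    (z : Fin n → R) (p : MvPolynomial (Fin n) K) : coeff 0 (translate z p) = aeval z p := by
  have h : (((aeval (fun _ => 0) : MvPolynomial (Fin n) R →ₐ[R] R).restrictScalars K).comp
      (translate z)) = aeval z := by
    ext i; simp
  rw [← h]
  simp [constantCoeff_eq]

/-- Taylor's formula: derivatives commute with translation, and at the origin they read off
coefficients up to `γ!`. -/
theorem aeval_iterPDeriv {K R : Type*} [CommRing K] [CommRing R] [Algebra K R] {n : ℕ}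
    (z : Fin n → R) (γ : Fin n →₀ ℕ) (p : MvPolynomial (Fin n) K) :
    aeval z (iterPDeriv γ p) = coeff γ (translate z p) * ∏ i, ((γ i).factorial : R) := by
  rw [← coeff_zero_translate, ← iterPDeriv_translate, coeff_zero_iterPDeriv]

theorem shiftedMonomial_zero {n : ℕ} (ξ : Fin n → ℂ) : shiftedMonomial ξ 0 = 1 := by
  simp [shiftedMonomial]

theorem shiftedMonomial_add_single {n : ℕ} (ξ : Fin n → ℂ) (β : Fin n →₀ ℕ) (j : Fin n) :
    shiftedMonomial ξ (β + Finsupp.single j 1) = (X j - C (ξ j)) * shiftedMonomial ξ β := by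
  simp only [shiftedMonomial, Finsupp.add_apply, pow_add, Finset.prod_mul_distrib]
  rw [mul_comm, Finset.prod_eq_single j]
  · simp
  · intro i _ hi; simp [Finsupp.single_eq_of_ne hi]
  · simp

open scoped IsMulCommutative in
/-- Commuting elements define an evaluation homomorphism on polynomials. -/
theorem exists_algHom_of_commute {K A : Type*} [CommRing K] [Ring A] [Algebra K A] {n : ℕ}
    (a : Fin n → A) (h : ∀ i j, a i * a j = a j * a i) :
    ∃ Φ : MvPolynomial (Fin n) K →ₐ[K] A, ∀ i, Φ (X i) = a i := by
  have : IsMulCommutative (Algebra.adjoin K (Set.range a)) := Algebra.isMulCommutative_adjoin K (by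
    rintro _ ⟨i, rfl⟩ _ ⟨j, rfl⟩; exact h i j)
  let b : Fin n → Algebra.adjoin K (Set.range a) := fun i => ⟨a i, Algebra.subset_adjoin ⟨i, rfl⟩⟩
  refine ⟨(Algebra.adjoin K (Set.range a)).val.comp (aeval b), fun i => ?_⟩
  simp [b]

theorem algHom_eq_sum {R A : Type*} [CommRing R] [Ring A] [Algebra R A] {n : ℕ}
    (Ψ : MvPolynomial (Fin n) R →ₐ[R] A) (q : MvPolynomial (Fin n) R)
    {S : Finset (Fin n →₀ ℕ)} (hS : q.support ⊆ S) :
    Ψ q = ∑ γ ∈ S, coeff γ q • (List.ofFn fun j => Ψ (X j) ^ γ j).prod := by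
  have hmon : ∀ γ : Fin n →₀ ℕ, Ψ (monomial γ 1) = (List.ofFn fun j => Ψ (X j) ^ γ j).prod := by
    intro γ
    have : (monomial γ 1 : MvPolynomial (Fin n) R) = (List.ofFn fun j => X j ^ γ j).prod := by
      rw [List.prod_ofFn, monomial_eq, Finsupp.prod_fintype _ _ (by simp)]; simp
    rw [this, map_list_prod, List.map_ofFn]
    congr 2; ext j; simp
  have hq : q = ∑ γ ∈ S, coeff γ q • monomial γ (1 : R) := by
    conv_lhs => rw [q.as_sum]
    rw [Finset.sum_subset hS]
    · simp [smul_monomial]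
    · intro γ _ hγ; rw [notMem_support_iff.mp hγ, monomial_zero]
  conv_lhs => rw [hq]
  simp [hmon]

/-! ### Evaluation at triangular matrices -/

/-- Adding a strictly lower triangular `M_j` to the scalar `z_j` does not affect the diagonal, and
lower triangular matrices are closed under sums and products. -/
theorem algHom_isLowerTriangular {K R : Type*} [CommRing K] [CommRing R] [Algebra K R] {n δ : ℕ}
    (z : Fin n → R) (M : Fin n → Matrix (Fin δ) (Fin δ) R)
    (hM : ∀ j i k, i ≤ k → M j i k = 0)
    (Φ : MvPolynomial (Fin n) K →ₐ[K] Matrix (Fin δ) (Fin δ) R)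
    (hΦ : ∀ j, Φ (X j) = z j • 1 + M j) (p : MvPolynomial (Fin n) K) :
    (∀ i k, i < k → Φ p i k = 0) ∧ ∀ i, Φ p i i = aeval z p := by
  induction p using MvPolynomial.induction_on with
  | C a =>
    rw [← algebraMap_eq, AlgHom.commutes, AlgHom.commutes]
    refine ⟨fun i k hik => ?_, fun i => ?_⟩
    · rw [Matrix.algebraMap_matrix_apply, if_neg hik.ne]
    · rw [Matrix.algebraMap_matrix_apply, if_pos rfl]
  | add p q hp hq =>
    refine ⟨fun i k hik => ?_, fun i => ?_⟩
    · simp [hp.1 i k hik, hq.1 i k hik]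
    · simp [hp.2 i, hq.2 i]
  | mul_X p j hp =>
    have hz : ∀ i k, i ≤ k → (Φ p * M j) i k = 0 := by
      intro i k hik
      rw [Matrix.mul_apply]
      refine Finset.sum_eq_zero fun l _ => ?_
      rcases lt_or_ge i l with h | h
      · rw [hp.1 i l h, zero_mul]
      · rw [hM j l k (h.trans hik), mul_zero]
    rw [map_mul, hΦ, mul_add, mul_smul_comm, mul_one, map_mul, aeval_X]
    refine ⟨fun i k hik => ?_, fun i => ?_⟩
    · simp [hp.1 i k hik, hz i k hik.le]
    · simp [hp.2 i, hz i i le_rfl, mul_comm]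

theorem det_algHom_of_triangular {K R : Type*} [CommRing K] [CommRing R] [Algebra K R] {n δ : ℕ}
    (z : Fin n → R) (M : Fin n → Matrix (Fin δ) (Fin δ) R)
    (hM : ∀ j i k, i ≤ k → M j i k = 0)
    (Φ : MvPolynomial (Fin n) K →ₐ[K] Matrix (Fin δ) (Fin δ) R)
    (hΦ : ∀ j, Φ (X j) = z j • 1 + M j) (p : MvPolynomial (Fin n) K) :
    (Φ p).det = aeval z p ^ δ := by
  obtain ⟨h1, h2⟩ := algHom_isLowerTriangular z M hM Φ hΦ p
  rw [Matrix.det_of_isLowerTriangular _ fun i k hik => h1 i k hik]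
  simp [h2]

/-- Commuting matrices `M_j` define an evaluation of polynomials at the matrices `z_j + M_j`. -/
theorem exists_algHom_shifted {K R : Type*} [CommRing K] [CommRing R] [Algebra K R] {n δ : ℕ}
    (z : Fin n → R) (M : Fin n → Matrix (Fin δ) (Fin δ) R) (hM : ∀ i j, M i * M j = M j * M i) :
    ∃ Φ : MvPolynomial (Fin n) K →ₐ[K] Matrix (Fin δ) (Fin δ) R,
      ∀ j, Φ (X j) = z j • 1 + M j := by
  refine exists_algHom_of_commute _ fun i j => ?_
  have h1 : ∀ (a : R) (A : Matrix (Fin δ) (Fin δ) R), Commute (a • 1) A := fun a A =>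
    (Commute.one_left A).smul_left a
  exact ((h1 _ _).add_right (h1 _ _)).add_left ((h1 _ _).symm.add_right (hM i j))

/-- Multiplying by the adjugate shows that a nonzerodivisor determinant suffices; it need not be a
unit. -/
theorem eq_zero_of_mulVec_eq_zero_of_det {R : Type*} [CommRing R] {δ : ℕ}
    (A : Matrix (Fin δ) (Fin δ) R) (hA : ∀ r, A.det * r = 0 → r = 0) (v : Fin δ → R)
    (h : A.mulVec v = 0) : v = 0 := by
  have h1 : A.adjugate.mulVec (A.mulVec v) = A.det • v := by
    rw [Matrix.mulVec_mulVec, Matrix.adjugate_mul, Matrix.smul_mulVec, Matrix.one_mulVec]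
  rw [h, Matrix.mulVec_zero] at h1
  funext i
  exact hA _ (congrFun h1.symm i)

/-! ### Differential functionals -/

theorem applyAt_eq_sum_coeff {n : ℕ} (ξ : Fin n → ℂ) (L p : MvPolynomial (Fin n) ℂ)
    {S : Finset (Fin n →₀ ℕ)} (hS : L.support ⊆ S) :
    applyAt ξ L p =
      ∑ β ∈ S, coeff β L * (coeff β (translate ξ p) * ∏ i, ((β i).factorial : ℂ)) := by
  rw [applyAt_eq_sum ξ L p hS]
  refine Finset.sum_congr rfl fun β _ => ?_
  rw [← aeval_iterPDeriv, aeval_eq_eval]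

/-- `L(p)` as a linear function of the functional `L`. -/
def applyLeft {n : ℕ} (ξ : Fin n → ℂ) (p : MvPolynomial (Fin n) ℂ) :
    MvPolynomial (Fin n) ℂ →ₗ[ℂ] ℂ where
  toFun L := applyAt ξ L p
  map_add' a b := by
    classical
    rw [applyAt_eq_sum ξ a p (S := a.support ∪ b.support) Finset.subset_union_left,
      applyAt_eq_sum ξ b p (S := a.support ∪ b.support) Finset.subset_union_right,
      applyAt_eq_sum ξ (a + b) p (S := a.support ∪ b.support) support_add]
    simp only [coeff_add, add_mul, Finset.sum_add_distrib]
  map_smul' c a := by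
    rw [applyAt_eq_sum ξ (c • a) p (S := a.support) support_smul]
    simp only [applyAt, coeff_smul, smul_eq_mul, mul_assoc, ← Finset.mul_sum, RingHom.id_apply]

/-- `L(p)` as a linear function of the polynomial `p`. -/
def applyRight {n : ℕ} (ξ : Fin n → ℂ) (L : MvPolynomial (Fin n) ℂ) :
    MvPolynomial (Fin n) ℂ →ₗ[ℂ] ℂ where
  toFun p := applyAt ξ L p
  map_add' p q := by simp [applyAt, mul_add, Finset.sum_add_distrib]
  map_smul' c p := by simp [applyAt, Finset.mul_sum, mul_left_comm, smul_eval]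

theorem applyLeft_apply {n : ℕ} (ξ : Fin n → ℂ) (L p : MvPolynomial (Fin n) ℂ) :
    applyLeft ξ p L = applyAt ξ L p := rfl

theorem applyRight_apply {n : ℕ} (ξ : Fin n → ℂ) (L p : MvPolynomial (Fin n) ℂ) :
    applyRight ξ L p = applyAt ξ L p := rfl

theorem applyAt_monomial {n : ℕ} (ξ : Fin n → ℂ) (s : Fin n →₀ ℕ) (a : ℂ)
    (p : MvPolynomial (Fin n) ℂ) :
    applyAt ξ (monomial s a) p =
      a * (coeff s (translate ξ p) * ∏ i, ((s i).factorial : ℂ)) := by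
  rw [applyAt_eq_sum_coeff ξ _ p (support_monomial_subset), Finset.sum_singleton, coeff_monomial,
    if_pos rfl]

theorem prod_factorial_add_single {n : ℕ} (s : Fin n →₀ ℕ) (j : Fin n) :
    (∏ i, (((s + Finsupp.single j 1 : Fin n →₀ ℕ) i).factorial : ℂ)) =
      (s j + 1 : ℂ) * ∏ i, ((s i).factorial : ℂ) := by
  rw [← Finset.mul_prod_erase _ _ (Finset.mem_univ j),
    ← Finset.mul_prod_erase _ (fun i => ((s i).factorial : ℂ)) (Finset.mem_univ j), ← mul_assoc]
  congr 1
  · simp [Nat.factorial_succ]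
  · refine Finset.prod_congr rfl fun i hi => ?_
    simp [Finsupp.single_eq_of_ne (Finset.ne_of_mem_erase hi)]

/-- Multiplication by `x_j - ξ_j` is transposed to the derivation by `∂_j`. -/
theorem applyAt_X_sub_C_mul {n : ℕ} (ξ : Fin n → ℂ) (j : Fin n) (L p : MvPolynomial (Fin n) ℂ) :
    applyAt ξ L ((X j - C (ξ j)) * p) = applyAt ξ (pderiv j L) p := by
  classical
  have h : applyLeft ξ ((X j - C (ξ j)) * p) =
      (applyLeft ξ p).comp (pderiv (R := ℂ) j).toLinearMap := by
    -- Both sides are linear in the functional, so monomials in the `∂`'s suffice. There the factor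
    -- `s j` of the derivative matches the ratio of the factorials of `s` and `s - e_j`.
    refine (basisMonomials (Fin n) ℂ).ext fun s => ?_
    rw [coe_basisMonomials]
    change applyAt ξ (monomial s 1) ((X j - C (ξ j)) * p) =
        applyAt ξ (pderiv j (monomial s 1)) p
    have ht : translate ξ ((X j - C (ξ j)) * p) = translate ξ p * X j := by
      rw [map_mul, map_sub, translate_X, ← algebraMap_eq, AlgHom.commutes, algebraMap_eq]
      ring
    rw [pderiv_monomial, applyAt_monomial, applyAt_monomial, ht, coeff_mul_X']
    by_cases hs : s j = 0
    · simp [hs]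
    · rw [if_pos (by simpa using hs)]
      obtain ⟨u, rfl⟩ : ∃ u, s = u + Finsupp.single j 1 :=
        ⟨s - Finsupp.single j 1, (tsub_add_cancel_of_le (by
          simpa [Nat.one_le_iff_ne_zero] using hs)).symm⟩
      rw [prod_factorial_add_single, add_tsub_cancel_right]
      simp only [Finsupp.add_apply, Finsupp.single_eq_same]
      push_cast
      ring
  exact LinearMap.congr_fun h L

theorem totalDegree_pderiv_lt {n : ℕ} (j : Fin n) (L : MvPolynomial (Fin n) ℂ)
    (hL : L.totalDegree ≠ 0) : (pderiv j L).totalDegree < L.totalDegree := by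
  refine (Finset.sup_lt_iff (Nat.pos_of_ne_zero hL)).mpr fun s hs => ?_
  have h : s + Finsupp.single j 1 ∈ L.support := by
    rw [mem_support_iff] at hs ⊢
    intro h0
    exact hs (by rw [coeff_pderiv, h0, zero_mul])
  have h1 := le_totalDegree h
  rw [Finsupp.sum_add_index' (by simp) (by simp), Finsupp.sum_single_index rfl] at h1
  omega

/-! ### The dual basis and its multiplication matrices -/

/-- The matrix of the multiplication by `x_j - ξ_j` in the primal basis. -/
def dualMatrix {n δ : ℕ} (ξ : Fin n → ℂ) (α : Fin δ → Fin n →₀ ℕ)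
    (Λ : Fin δ → MvPolynomial (Fin n) ℂ) (j : Fin n) : Matrix (Fin δ) (Fin δ) ℂ :=
  Matrix.of fun i k => applyAt ξ (Λ i) (shiftedMonomial ξ (α k + Finsupp.single j 1))

/-- The vector `(Λ_0(p), …, Λ_{δ-1}(p))`. -/
def dualVec {n δ : ℕ} (ξ : Fin n → ℂ) (Λ : Fin δ → MvPolynomial (Fin n) ℂ)
    (p : MvPolynomial (Fin n) ℂ) : Fin δ → ℂ :=
  fun i => applyAt ξ (Λ i) p

theorem dualMatrix_apply {n δ : ℕ} (ξ : Fin n → ℂ) (α : Fin δ → Fin n →₀ ℕ)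
    (Λ : Fin δ → MvPolynomial (Fin n) ℂ) (i k : Fin δ) (j : Fin n) :
    dualMatrix ξ α Λ j i k = applyAt ξ (pderiv j (Λ i)) (shiftedMonomial ξ (α k)) := by
  rw [dualMatrix, Matrix.of_apply, shiftedMonomial_add_single, applyAt_X_sub_C_mul]

theorem pderiv_mem_inverseSystem {n : ℕ} {I : Ideal (MvPolynomial (Fin n) ℂ)} {ξ : Fin n → ℂ}
    {L : MvPolynomial (Fin n) ℂ} (hL : L ∈ inverseSystem I ξ) (j : Fin n) :
    pderiv j L ∈ inverseSystem I ξ := by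
  intro p hp
  rw [← applyAt_X_sub_C_mul]
  exact hL _ (I.mul_mem_left _ hp)

namespace IsPrimalDualPair

variable {n δ : ℕ} [NeZero δ] {I : Ideal (MvPolynomial (Fin n) ℂ)} {ξ : Fin n → ℂ}
  {α : Fin δ → Fin n →₀ ℕ} {Λ : Fin δ → MvPolynomial (Fin n) ℂ}

theorem injective (h : IsPrimalDualPair I ξ α Λ) : Function.Injective α := by
  intro i j hij
  by_contra hne
  have h1 := h.orthogonal i j
  rw [← hij, h.orthogonal i i, if_pos rfl, if_neg hne] at h1
  exact one_ne_zero h1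

/-- The filtration axiom at `t = L.totalDegree` puts `L` in the span of the `Λ k`; orthogonality
then identifies the coefficients. -/
theorem eq_sum_of_mem (h : IsPrimalDualPair I ξ α Λ) {L : MvPolynomial (Fin n) ℂ}
    (hL : L ∈ inverseSystem I ξ) :
    L = ∑ k, applyLeft ξ (shiftedMonomial ξ (α k)) L • Λ k := by
  have hs : L ∈ inverseSystem I ξ ⊓ restrictTotalDegree (Fin n) ℂ L.totalDegree :=
    ⟨hL, (mem_restrictTotalDegree _ _ _).mpr le_rfl⟩
  rw [h.filtration] at hs
  clear hL
  generalize L.totalDegree = t at hs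
  induction hs using Submodule.span_induction with
  | mem x hx =>
    obtain ⟨j, rfl, -⟩ := hx
    simp [applyLeft_apply, h.orthogonal]
  | zero => simp
  | add x y _ _ hx hy =>
    simp only [map_add, add_smul, Finset.sum_add_distrib]
    rw [← hx, ← hy]
  | smul c x _ hx =>
    simp only [map_smul, smul_assoc, ← Finset.smul_sum]
    rw [← hx]

/-- Since `∂_j` lowers the order and preserves the inverse system, `∂_j Λ_i` is a combination of
`Λ_l` of smaller order, hence with `l < i`; these vanish on `(x - ξ)^{α_k}` for `k ≥ i`. -/
theorem dualMatrix_eq_zero (h : IsPrimalDualPair I ξ α Λ) (j : Fin n) (i k : Fin δ)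
    (hik : i ≤ k) : dualMatrix ξ α Λ j i k = 0 := by
  rw [dualMatrix_apply]
  by_cases h0 : (Λ i).totalDegree = 0
  · rw [totalDegree_eq_zero_iff_eq_C.mp h0, pderiv_C]
    exact map_zero (applyLeft ξ (shiftedMonomial ξ (α k)))
  · have hlt := totalDegree_pderiv_lt j (Λ i) h0
    have hs : pderiv j (Λ i) ∈ inverseSystem I ξ ⊓
        restrictTotalDegree (Fin n) ℂ ((Λ i).totalDegree - 1) :=
      ⟨pderiv_mem_inverseSystem (h.mem_inverseSystem i) j,
        (mem_restrictTotalDegree _ _ _).mpr (by omega)⟩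
    rw [h.filtration] at hs
    suffices hle : Submodule.span ℂ {L | ∃ l, L = Λ l ∧ (Λ l).totalDegree ≤
        (Λ i).totalDegree - 1} ≤ LinearMap.ker (applyLeft ξ (shiftedMonomial ξ (α k))) from hle hs
    refine Submodule.span_le.mpr ?_
    rintro _ ⟨l, rfl, hl⟩
    have hli : l < i := lt_of_not_ge fun hil => by
      have : (Λ i).totalDegree ≤ (Λ l).totalDegree := h.monotone_order hil
      omega
    change applyAt ξ (Λ l) (shiftedMonomial ξ (α k)) = 0
    rw [h.orthogonal, if_neg (hli.trans_le hik).ne]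

theorem dualVec_X_sub_C_mul (h : IsPrimalDualPair I ξ α Λ) (j : Fin n)
    (p : MvPolynomial (Fin n) ℂ) :
    dualVec ξ Λ ((X j - C (ξ j)) * p) = (dualMatrix ξ α Λ j).mulVec (dualVec ξ Λ p) := by
  funext i
  have h1 := h.eq_sum_of_mem (pderiv_mem_inverseSystem (h.mem_inverseSystem i) j)
  rw [dualVec, applyAt_X_sub_C_mul, h1, ← applyLeft_apply, map_sum]
  simp [Matrix.mulVec, dotProduct, dualMatrix_apply, dualVec, applyLeft_apply]

theorem dualVec_shiftedMonomial (h : IsPrimalDualPair I ξ α Λ) (k : Fin δ) :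
    dualVec ξ Λ (shiftedMonomial ξ (α k)) = Pi.single k 1 := by
  funext i
  rw [dualVec, h.orthogonal, Pi.single_apply]

theorem dualVec_one (h : IsPrimalDualPair I ξ α Λ) : dualVec ξ Λ 1 = Pi.single 0 1 := by
  rw [← h.dualVec_shiftedMonomial 0, h.exponent_zero, shiftedMonomial_zero]

theorem dualMatrix_commute (h : IsPrimalDualPair I ξ α Λ) (i j : Fin n) :
    dualMatrix ξ α Λ i * dualMatrix ξ α Λ j = dualMatrix ξ α Λ j * dualMatrix ξ α Λ i := by
  refine Matrix.ext_of_mulVec_single fun k => ?_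
  rw [← Matrix.mulVec_mulVec, ← Matrix.mulVec_mulVec, ← h.dualVec_shiftedMonomial,
    ← h.dualVec_X_sub_C_mul, ← h.dualVec_X_sub_C_mul, ← h.dualVec_X_sub_C_mul,
    ← h.dualVec_X_sub_C_mul, mul_left_comm]

/-- The multiplication by polynomials, written in the dual basis. -/
theorem dualVec_mul (h : IsPrimalDualPair I ξ α Λ)
    (Φ : MvPolynomial (Fin n) ℂ →ₐ[ℂ] Matrix (Fin δ) (Fin δ) ℂ)
    (hΦ : ∀ j, Φ (X j) = ξ j • 1 + dualMatrix ξ α Λ j) (p q : MvPolynomial (Fin n) ℂ) :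
    dualVec ξ Λ (p * q) = (Φ p).mulVec (dualVec ξ Λ q) := by
  have hadd : ∀ a b, dualVec ξ Λ (a + b) = dualVec ξ Λ a + dualVec ξ Λ b := fun a b =>
    funext fun i => map_add (applyRight ξ (Λ i)) a b
  have hsmul : ∀ (c : ℂ) b, dualVec ξ Λ (c • b) = c • dualVec ξ Λ b := fun c b =>
    funext fun i => map_smul (applyRight ξ (Λ i)) c b
  induction p using MvPolynomial.induction_on generalizing q with
  | C a =>
    rw [← algebraMap_eq, AlgHom.commutes, ← Algebra.smul_def, hsmul,
      Algebra.algebraMap_eq_smul_one, Matrix.smul_mulVec, Matrix.one_mulVec]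
  | add p p' hp hp' => rw [add_mul, hadd, hp, hp', map_add, Matrix.add_mulVec]
  | mul_X p j hp =>
    have hq : X j * q = ξ j • q + (X j - C (ξ j)) * q := by rw [smul_eq_C_mul]; ring
    rw [mul_assoc, hp, map_mul, ← Matrix.mulVec_mulVec, hΦ, hq, hadd, hsmul,
      h.dualVec_X_sub_C_mul, Matrix.add_mulVec, Matrix.smul_mulVec, Matrix.one_mulVec]

theorem exists_dualHom (h : IsPrimalDualPair I ξ α Λ) :
    ∃ Φ : MvPolynomial (Fin n) ℂ →ₐ[ℂ] Matrix (Fin δ) (Fin δ) ℂ,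
      ∀ j, Φ (X j) = ξ j • 1 + dualMatrix ξ α Λ j := by
  exact exists_algHom_shifted ξ _ h.dualMatrix_commute

/-- The `Λ_i` kill `I` by definition. They also kill `Q` because a multiplier `p` with `p(ξ) ≠ 0`
acts on the dual vectors by a matrix of determinant `p(ξ)^δ`. -/
theorem dualVec_eq_zero (h : IsPrimalDualPair I ξ α Λ) {q : MvPolynomial (Fin n) ℂ}
    (hq : q ∈ primaryComponentAt I ξ) : dualVec ξ Λ q = 0 := by
  obtain ⟨p, hp, hpq⟩ := hq
  obtain ⟨Φ, hΦ⟩ := h.exists_dualHom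
  refine eq_zero_of_mulVec_eq_zero_of_det (Φ p) ?_ _ ?_
  · intro r hr
    rw [det_algHom_of_triangular ξ _ h.dualMatrix_eq_zero Φ hΦ, aeval_eq_eval] at hr
    exact (mul_eq_zero.mp hr).resolve_left (pow_ne_zero _ hp)
  · rw [← h.dualVec_mul Φ hΦ]
    funext i
    exact h.mem_inverseSystem i _ hpq

/-- Reduction modulo `Q` to the primal basis: since the `Λ_i` vanish on `Q`, orthogonality shows
that they compute the coordinates. -/
theorem sub_sum_mem (h : IsPrimalDualPair I ξ α Λ) (p : MvPolynomial (Fin n) ℂ) :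
    p - ∑ i, applyAt ξ (Λ i) p • shiftedMonomial ξ (α i) ∈ primaryComponentAt I ξ := by
  have hp : Ideal.Quotient.mk (primaryComponentAt I ξ) p ∈ Submodule.span ℂ (Set.range fun i =>
      Ideal.Quotient.mk (primaryComponentAt I ξ) (shiftedMonomial ξ (α i))) := by
    rw [h.span_eq_top]; trivial
  obtain ⟨c, hc⟩ := (Submodule.mem_span_range_iff_exists_fun ℂ).mp hp
  have hmem : p - ∑ i, c i • shiftedMonomial ξ (α i) ∈ primaryComponentAt I ξ := by
    rw [← Ideal.Quotient.eq_zero_iff_mem, map_sub, map_sum, ← hc, sub_eq_zero]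
    rfl
  have hcj : ∀ j, applyAt ξ (Λ j) p = c j := by
    intro j
    have h0 : applyRight ξ (Λ j) (p - ∑ i, c i • shiftedMonomial ξ (α i)) = 0 :=
      congrFun (h.dualVec_eq_zero hmem) j
    rw [map_sub, map_sum, sub_eq_zero] at h0
    rw [← applyRight_apply, h0]
    simp [applyRight_apply, h.orthogonal]
  simpa only [hcj] using hmem

end IsPrimalDualPair

/-! ### The parametric matrices at a point -/

open Classical in
/-- The matrix `M_j(μ)` at the point `y = (z, μ)`. -/
def paramMatrixAt {R : Type*} [CommRing R] {n δ : ℕ} (α : Fin δ → Fin n →₀ ℕ)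
    (y : Fin n ⊕ Param α → R) (j : Fin n) : Matrix (Fin δ) (Fin δ) R :=
  Matrix.of fun i k =>
    if hki : k < i then
      if α i = α k + Finsupp.single j 1 then 1
      else if hE : α k + Finsupp.single j 1 ∈ Set.range α then 0
      else y (Sum.inr ⟨(i, α k + Finsupp.single j 1), hE, k, hki, j, rfl⟩)
    else 0

theorem map_paramMatrix {K R : Type*} [Field K] [CommRing R] [Algebra K R] {n δ : ℕ}
    (α : Fin δ → Fin n →₀ ℕ) (y : Fin n ⊕ Param α → R) (j : Fin n) :
    (paramMatrix K α j).map (aeval y) = paramMatrixAt α y j := by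
  ext i k
  simp only [paramMatrix, paramMatrixAt, Matrix.map_apply, Matrix.of_apply]
  split_ifs <;> simp

theorem paramMatrixAt_eq_zero {R : Type*} [CommRing R] {n δ : ℕ} (α : Fin δ → Fin n →₀ ℕ)
    (y : Fin n ⊕ Param α → R) (j : Fin n) (i k : Fin δ) (hik : i ≤ k) :
    paramMatrixAt α y j i k = 0 := by
  rw [paramMatrixAt, Matrix.of_apply, dif_neg hik.not_gt]

theorem paramMatrixAt_mulVec_single {R : Type*} [CommRing R] {n δ : ℕ} {α : Fin δ → Fin n →₀ ℕ}
    (hα : Function.Injective α) (y : Fin n ⊕ Param α → R) (j : Fin n) {i l : Fin δ} (hl : l < i)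
    (h : α i = α l + Finsupp.single j 1) :
    (paramMatrixAt α y j).mulVec (Pi.single l 1) = Pi.single i 1 := by
  rw [Matrix.mulVec_single_one]
  funext i'
  have hE : α l + Finsupp.single j 1 ∈ Set.range α := ⟨i, h⟩
  rw [Matrix.col_apply, paramMatrixAt, Matrix.of_apply]
  by_cases hi : i' = i
  · subst hi
    rw [dif_pos hl, if_pos h, Pi.single_eq_same]
  · have hne : α i' ≠ α l + Finsupp.single j 1 := fun e => hi (hα (e.trans h.symm))
    rw [Pi.single_eq_of_ne hi]
    by_cases hl' : l < i'
    · rw [dif_pos hl', if_neg hne, dif_pos hE]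
    · rw [dif_neg hl']

/-- The normal form at `(z, μ)` is the evaluation at the matrices `z_j + M_j(μ)`, applied to `[1]`. -/
theorem aeval_paramNormalForm {K R : Type*} [Field K] [CharZero K] [CommRing R] [Algebra K R]
    {n δ : ℕ} [NeZero δ] (α : Fin δ → Fin n →₀ ℕ) (y : Fin n ⊕ Param α → R)
    (hM : ∀ i j, paramMatrixAt α y i * paramMatrixAt α y j =
      paramMatrixAt α y j * paramMatrixAt α y i)
    (Φ : MvPolynomial (Fin n) K →ₐ[K] Matrix (Fin δ) (Fin δ) R)
    (hΦ : ∀ j, Φ (X j) = y (Sum.inl j) • 1 + paramMatrixAt α y j)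
    (p : MvPolynomial (Fin n) K) (i : Fin δ) :
    aeval y (paramNormalForm α p i) = (Φ p).mulVec (Pi.single 0 1) i := by
  classical
  obtain ⟨Ψ, hΨ⟩ := exists_algHom_of_commute (K := R) _ hM
  set z : Fin n → R := fun j => y (Sum.inl j) with hz
  have hΦΨ : Φ p = Ψ (translate z p) := by
    have : Φ = (Ψ.restrictScalars K).comp (translate z) := by
      ext j : 1
      rw [hΦ, AlgHom.comp_apply, translate_X, AlgHom.restrictScalars_apply, map_add, hΨ,
        ← algebraMap_eq, AlgHom.commutes, Algebra.algebraMap_eq_smul_one, add_comm]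
    rw [this]; rfl
  -- One finite index set containing both supports, so that the two sums can be compared term by
  -- term.
  set S := (paramNormalForm_finite α p).toFinset ∪ (translate z p).support with hS
  rw [hΦΨ, algHom_eq_sum Ψ (translate z p) (S := S) Finset.subset_union_right, paramNormalForm,
    finsum_eq_sum_of_support_subset (s := S) _ (by
      rw [hS, Finset.coe_union, Set.Finite.coe_toFinset]; exact Set.subset_union_left),
    Finset.sum_apply, map_sum, Matrix.sum_mulVec, Finset.sum_apply]
  refine Finset.sum_congr rfl fun γ _ => ?_
  have hpow : (paramMatrixPow K α γ).map (aeval y) =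
      (List.ofFn fun j => Ψ (X j) ^ γ j).prod := by
    have h := map_list_prod (aeval (R := K) y : _ →ₐ[K] R).mapMatrix
      (List.ofFn fun j => paramMatrix K α j ^ γ j)
    rw [List.map_ofFn] at h
    refine h.trans ?_
    congr 2
    funext j
    rw [Function.comp_apply, map_pow, hΨ, ← map_paramMatrix (K := K)]
    rfl
  have hfac : algebraMap K R ((∏ i, ((γ i).factorial : K))⁻¹) * ∏ i, ((γ i).factorial : R) = 1 := by
    have h0 : (∏ i, ((γ i).factorial : K)) ≠ 0 :=
      Finset.prod_ne_zero_iff.mpr fun i _ => Nat.cast_ne_zero.mpr (Nat.factorial_ne_zero _)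
    have h1 : (∏ i, ((γ i).factorial : R)) = algebraMap K R (∏ i, ((γ i).factorial : K)) := by
      simp
    rw [h1, ← map_mul, inv_mul_cancel₀ h0, map_one]
  rw [← hpow, Pi.smul_apply, smul_eq_mul, map_mul, map_mul, aeval_C, aeval_rename,
    Matrix.smul_mulVec, Pi.smul_apply, smul_eq_mul]
  have hcomp : (y ∘ Sum.inl : Fin n → R) = z := rfl
  rw [hcomp, aeval_iterPDeriv]
  have hvec : aeval y ((paramMatrixPow K α γ).mulVec (Pi.single 0 1) i) =
      ((paramMatrixPow K α γ).map (aeval y)).mulVec (Pi.single 0 1) i := by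
    rw [Matrix.mulVec_single_one, Matrix.mulVec_single_one]; rfl
  rw [hvec]
  linear_combination (coeff γ (translate z p) *
    ((paramMatrixPow K α γ).map (aeval y)).mulVec (Pi.single 0 1) i) * hfac

namespace IsPrimalDualPair

variable {n δ : ℕ} [NeZero δ] {I : Ideal (MvPolynomial (Fin n) ℂ)} {ξ : Fin n → ℂ}
  {α : Fin δ → Fin n →₀ ℕ} {Λ : Fin δ → MvPolynomial (Fin n) ℂ}

/-- Otherwise the entry `Λ_i((x - ξ)^{α_i}) = 1` of `D_j` would lie on or above the diagonal. -/
theorem lt_of_eq_add_single (h : IsPrimalDualPair I ξ α Λ) {i l : Fin δ} {j : Fin n}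
    (hi : α i = α l + Finsupp.single j 1) : l < i := by
  by_contra hl
  have h0 := h.dualMatrix_eq_zero j i l (not_lt.mp hl)
  rw [dualMatrix, Matrix.of_apply, ← hi, h.orthogonal, if_pos rfl] at h0
  exact one_ne_zero h0

/-- The parametric matrices at `ν` are the multiplication matrices of the dual basis. -/
theorem paramMatrixAt_dualParam (h : IsPrimalDualPair I ξ α Λ) (j : Fin n) :
    paramMatrixAt α (Sum.elim ξ (dualParam ξ α Λ)) j = dualMatrix ξ α Λ j := by
  ext i k
  by_cases hki : k < i
  · rw [paramMatrixAt, Matrix.of_apply, dif_pos hki, dualMatrix, Matrix.of_apply]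
    by_cases h1 : α i = α k + Finsupp.single j 1
    · rw [if_pos h1, ← h1, h.orthogonal, if_pos rfl]
    · rw [if_neg h1]
      by_cases hE : α k + Finsupp.single j 1 ∈ Set.range α
      · rw [dif_pos hE]
        obtain ⟨l, hl⟩ := hE
        rw [← hl, h.orthogonal, if_neg]
        rintro rfl
        exact h1 hl
      · rw [dif_neg hE]
        rfl
  · rw [paramMatrixAt_eq_zero _ _ _ _ _ (not_lt.mp hki), h.dualMatrix_eq_zero _ _ _ (not_lt.mp hki)]

theorem aeval_paramNormalForm_dualParam {K : Type*} [Field K] [Algebra K ℂ]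
    (h : IsPrimalDualPair I ξ α Λ) (p : MvPolynomial (Fin n) K) (i : Fin δ) :
    aeval (Sum.elim ξ (dualParam ξ α Λ)) (paramNormalForm α p i) =
      applyAt ξ (Λ i) (MvPolynomial.map (algebraMap K ℂ) p) := by
  have : CharZero K := (algebraMap K ℂ).charZero_iff (algebraMap K ℂ).injective |>.mpr inferInstance
  obtain ⟨Φ, hΦ⟩ := h.exists_dualHom
  have hM : ∀ i j, paramMatrixAt α (Sum.elim ξ (dualParam ξ α Λ)) i *
      paramMatrixAt α (Sum.elim ξ (dualParam ξ α Λ)) j =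
      paramMatrixAt α (Sum.elim ξ (dualParam ξ α Λ)) j *
      paramMatrixAt α (Sum.elim ξ (dualParam ξ α Λ)) i := fun i j => by
    rw [h.paramMatrixAt_dualParam, h.paramMatrixAt_dualParam, h.dualMatrix_commute]
  rw [aeval_paramNormalForm α _ hM ((Φ.restrictScalars K).comp (mapAlgHom (Algebra.ofId K ℂ)))
    (fun j => ?_)]
  · have h1 := congrFun (h.dualVec_mul Φ hΦ (MvPolynomial.map (algebraMap K ℂ) p) 1) i
    rw [mul_one, h.dualVec_one] at h1
    exact h1.symm
  · simp [hΦ, h.paramMatrixAt_dualParam]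

theorem aeval_deflatedSystem {K : Type*} [Field K] [Algebra K ℂ] {N : ℕ}
    {f : Fin N → MvPolynomial (Fin n) K} (h : IsPrimalDualPair (systemIdeal f) ξ α Λ)
    (e : (Fin N × Fin δ) ⊕ ((Fin n × Fin n) × (Fin δ × Fin δ))) :
    aeval (Sum.elim ξ (dualParam ξ α Λ)) (deflatedSystem α f e) = 0 := by
  rcases e with ⟨k, i⟩ | ⟨⟨a, b⟩, i, k⟩
  · rw [deflatedSystem, Sum.elim_inl, h.aeval_paramNormalForm_dualParam]
    exact h.mem_inverseSystem i _ (Ideal.subset_span ⟨k, rfl⟩)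
  · have h0 : (paramMatrix K α a * paramMatrix K α b - paramMatrix K α b * paramMatrix K α a).map
        (aeval (Sum.elim ξ (dualParam ξ α Λ))) = 0 := by
      rw [Matrix.map_sub _ (map_sub _), Matrix.map_mul, Matrix.map_mul, map_paramMatrix,
        map_paramMatrix, h.paramMatrixAt_dualParam, h.paramMatrixAt_dualParam,
        h.dualMatrix_commute, sub_self]
    exact congrFun (congrFun h0 i) k

end IsPrimalDualPair

/-! ### Trace comparison and commutation at a root -/

/-- Similar matrices have equal traces; here `S` may fail to be invertible, and its adjugate
replaces the inverse at the cost of a factor `S.det`. -/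
theorem det_mul_trace_eq {R : Type*} [CommRing R] {δ : ℕ} (S A B : Matrix (Fin δ) (Fin δ) R)
    (h : A * S = S * B) : S.det * A.trace = S.det * B.trace := by
  have h1 : (A * S * S.adjugate).trace = S.det * A.trace := by
    rw [mul_assoc, Matrix.mul_adjugate, mul_smul_comm, mul_one, Matrix.trace_smul, smul_eq_mul]
  have h2 : (S * B * S.adjugate).trace = S.det * B.trace := by
    rw [Matrix.trace_mul_comm, ← mul_assoc, Matrix.adjugate_mul, smul_mul_assoc, one_mul,
      Matrix.trace_smul, smul_eq_mul]
  rw [← h1, h, h2]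

theorem paramMatrixAt_commute {K R : Type*} [Field K] [CommRing R] [Algebra K R] {n N δ : ℕ}
    [NeZero δ] {f : Fin N → MvPolynomial (Fin n) K} {α : Fin δ → Fin n →₀ ℕ} {y : Fin n ⊕ Param α → R}
    (hy : ∀ e, aeval y (deflatedSystem α f e) = 0) (a b : Fin n) :
    paramMatrixAt α y a * paramMatrixAt α y b = paramMatrixAt α y b * paramMatrixAt α y a := by
  rw [← sub_eq_zero, ← map_paramMatrix (K := K), ← map_paramMatrix (K := K), ← Matrix.map_mul,
    ← Matrix.map_mul, ← Matrix.map_sub _ (map_sub _)]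
  ext i k
  exact hy (Sum.inr ((a, b), (i, k)))

/-! ### Uniqueness of the solution over the local algebra at `(ξ, ν)` -/

section Uniqueness

variable {K R : Type*} [Field K] [Algebra K ℂ] [CommRing R] [Algebra ℂ R] [Algebra K R]
  [IsScalarTower K ℂ R] {n N δ : ℕ} [NeZero δ] {f : Fin N → MvPolynomial (Fin n) K}
  {ξ : Fin n → ℂ} {α : Fin δ → Fin n →₀ ℕ} {Λ : Fin δ → MvPolynomial (Fin n) ℂ}

/-- The polynomials `p` with `Φ(p)[1] = 0` form an ideal, and the normal form equations put each
`f_k` in it. -/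
theorem algHom_mulVec_eq_zero_of_mem {y : Fin n ⊕ Param α → R}
    (hy : ∀ e, aeval y (deflatedSystem α f e) = 0)
    (Φ : MvPolynomial (Fin n) ℂ →ₐ[ℂ] Matrix (Fin δ) (Fin δ) R)
    (hΦ : ∀ j, Φ (X j) = y (Sum.inl j) • 1 + paramMatrixAt α y j)
    {p : MvPolynomial (Fin n) ℂ} (hp : p ∈ systemIdeal f) :
    (Φ p).mulVec (Pi.single 0 1) = 0 := by
  have : CharZero K := (algebraMap K ℂ).charZero_iff (algebraMap K ℂ).injective |>.mpr inferInstance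
  induction hp using Submodule.span_induction with
  | mem x hx =>
    obtain ⟨k, rfl⟩ := hx
    funext i
    have h := aeval_paramNormalForm α y (paramMatrixAt_commute hy)
      ((Φ.restrictScalars K).comp (mapAlgHom (Algebra.ofId K ℂ))) (fun j => by simp [hΦ]) (f k) i
    exact h.symm.trans (hy (Sum.inl (k, i)))
  | zero => rw [map_zero, Matrix.zero_mulVec]
  | add p q _ _ hp hq => rw [map_add, Matrix.add_mulVec, hp, hq, add_zero]
  | smul a p _ hp => rw [smul_eq_mul, map_mul, ← Matrix.mulVec_mulVec, hp, Matrix.mulVec_zero]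

theorem algHom_mulVec_eq_zero_of_mem_primaryComponentAt {x y}
    (hx : ∀ j, x (Sum.inl j) = ξ j)
    (hreg : ∀ g : MvPolynomial (Fin n ⊕ Param α) ℂ, eval x g ≠ 0 →
      ∀ r : R, aeval y g * r = 0 → r = 0)
    (hy : ∀ e, aeval y (deflatedSystem α f e) = 0)
    (Φ : MvPolynomial (Fin n) ℂ →ₐ[ℂ] Matrix (Fin δ) (Fin δ) R)
    (hΦ : ∀ j, Φ (X j) = y (Sum.inl j) • 1 + paramMatrixAt α y j)
    {q : MvPolynomial (Fin n) ℂ} (hq : q ∈ primaryComponentAt (systemIdeal f) ξ) :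
    (Φ q).mulVec (Pi.single 0 1) = 0 := by
  obtain ⟨p, hp, hpq⟩ := hq
  refine eq_zero_of_mulVec_eq_zero_of_det (Φ p) ?_ _ ?_
  · rw [det_algHom_of_triangular _ _ (paramMatrixAt_eq_zero α y) Φ hΦ]
    have h1 : aeval (fun j => y (Sum.inl j)) p ^ δ = aeval y (rename Sum.inl p ^ δ) := by
      rw [map_pow, aeval_rename]; rfl
    rw [h1]
    refine hreg _ ?_
    have h2 : x ∘ Sum.inl = ξ := funext hx
    rw [map_pow, eval_rename, h2]
    exact pow_ne_zero _ hp
  · rw [Matrix.mulVec_mulVec, ← map_mul]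
    exact algHom_mulVec_eq_zero_of_mem hy Φ hΦ hpq

/-- The hypothesis `hreg` plays the role of locality at `(ξ, ν)`: it allows cancelling `p(z)` when
`p(ξ) ≠ 0`, and also `δ · det S`. -/
theorem IsPrimalDualPair.eq_of_deflatedSystem_eq_zero
    (h : IsPrimalDualPair (systemIdeal f) ξ α Λ) {y : Fin n ⊕ Param α → R}
    (hreg : ∀ g : MvPolynomial (Fin n ⊕ Param α) ℂ,
      eval (Sum.elim ξ (dualParam ξ α Λ)) g ≠ 0 → ∀ r : R, aeval y g * r = 0 → r = 0)
    (hy : ∀ e, aeval y (deflatedSystem α f e) = 0) (s : Fin n ⊕ Param α) :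
    y s = algebraMap ℂ R (Sum.elim ξ (dualParam ξ α Λ) s) := by
  classical
  have hcomm := paramMatrixAt_commute hy
  obtain ⟨Φ, hΦ⟩ := exists_algHom_shifted (K := ℂ) (fun j => y (Sum.inl j)) _ hcomm
  set e0 : Fin δ → R := Pi.single 0 1 with he0
  have hred : ∀ p, (Φ p).mulVec e0 =
      ∑ i, algebraMap ℂ R (applyAt ξ (Λ i) p) • (Φ (shiftedMonomial ξ (α i))).mulVec e0 := by
    intro p
    have h0 := algHom_mulVec_eq_zero_of_mem_primaryComponentAt (fun _ => rfl) hreg hy Φ hΦ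
      (h.sub_sum_mem p)
    rw [map_sub, map_sum, Matrix.sub_mulVec, sub_eq_zero, Matrix.sum_mulVec] at h0
    rw [he0, h0]
    refine Finset.sum_congr rfl fun i _ => ?_
    rw [map_smul, Matrix.smul_mulVec, algebraMap_smul]
  set S : Matrix (Fin δ) (Fin δ) R :=
    Matrix.of fun i k => (Φ (shiftedMonomial ξ (α k))).mulVec e0 i with hS
  have hScol : ∀ k, S.mulVec (Pi.single k 1) = (Φ (shiftedMonomial ξ (α k))).mulVec e0 := by
    intro k
    rw [Matrix.mulVec_single_one]; rfl
  -- the traces of the multiplication operators agree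
  have hz : ∀ j, y (Sum.inl j) = algebraMap ℂ R (ξ j) := by
    intro j
    have hAB : Φ (X j) * S =
        S * (algebraMap ℂ R (ξ j) • 1 + (dualMatrix ξ α Λ j).map (algebraMap ℂ R)) := by
      refine Matrix.ext_of_mulVec_single fun k => ?_
      have hX : X j * shiftedMonomial ξ (α k) = ξ j • shiftedMonomial ξ (α k) +
          shiftedMonomial ξ (α k + Finsupp.single j 1) := by
        rw [shiftedMonomial_add_single, smul_eq_C_mul]; ring
      rw [← Matrix.mulVec_mulVec, hScol, Matrix.mulVec_mulVec, ← map_mul, hX, map_add, map_smul,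
        Matrix.add_mulVec, Matrix.smul_mulVec, ← Matrix.mulVec_mulVec, Matrix.add_mulVec,
        Matrix.mulVec_add, Matrix.smul_mulVec, Matrix.one_mulVec, Matrix.mulVec_smul, hScol,
        algebraMap_smul, hred (shiftedMonomial ξ (α k + Finsupp.single j 1)),
        Matrix.mulVec_single_one ((dualMatrix ξ α Λ j).map (algebraMap ℂ R))]
      congr 1
      funext i
      simp only [Finset.sum_apply, Pi.smul_apply, smul_eq_mul, Matrix.mulVec, dotProduct, hS,
        Matrix.of_apply, Matrix.col_apply, Matrix.map_apply, dualMatrix]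
      exact Finset.sum_congr rfl fun _ _ => mul_comm _ _
    have htr := det_mul_trace_eq _ _ _ hAB
    have hM0 : (paramMatrixAt α y j).trace = 0 :=
      Finset.sum_eq_zero fun i _ => paramMatrixAt_eq_zero α y j i i le_rfl
    have hD0 : ((dualMatrix ξ α Λ j).map (algebraMap ℂ R)).trace = 0 :=
      Finset.sum_eq_zero fun i _ => by
        rw [Matrix.diag_apply, Matrix.map_apply, h.dualMatrix_eq_zero j i i le_rfl, map_zero]
    rw [hΦ, Matrix.trace_add, Matrix.trace_add, hM0, hD0, Matrix.trace_smul, Matrix.trace_smul,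
      Matrix.trace_one, Fintype.card_fin, add_zero, add_zero, smul_eq_mul, smul_eq_mul] at htr
    -- A polynomial lift of `S`. Its value at `(ξ, ν)` is the identity matrix, which makes `hreg`
    -- applicable to its determinant.
    let T : Matrix (Fin δ) (Fin δ) (MvPolynomial (Fin n ⊕ Param α) ℂ) :=
      Matrix.of fun i k => paramNormalForm α (shiftedMonomial ξ (α k)) i
    have hTS : T.map (aeval y) = S := by
      ext i k
      exact aeval_paramNormalForm α y hcomm Φ hΦ _ i
    have hT1 : T.map (aeval (Sum.elim ξ (dualParam ξ α Λ))) = 1 := by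
      ext i k
      refine (h.aeval_paramNormalForm_dualParam _ i).trans ?_
      rw [Algebra.algebraMap_self, MvPolynomial.map_id, h.orthogonal, Matrix.one_apply]
    have hdet : aeval y T.det = S.det := by
      rw [← hTS]; exact (aeval y : _ →ₐ[ℂ] R).map_det T
    have hdet1 : eval (Sum.elim ξ (dualParam ξ α Λ)) T.det = 1 := by
      rw [← aeval_eq_eval, ← Matrix.det_one (n := Fin δ), ← hT1]
      exact (aeval (Sum.elim ξ (dualParam ξ α Λ)) : _ →ₐ[ℂ] ℂ).map_det T
    -- Both traces are `δ` times a scalar; `δ` is nonzero in `ℂ`, so `δ · det S` can be cancelled.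
    refine sub_eq_zero.mp (hreg (T.det * C (δ : ℂ)) ?_ _ ?_)
    · rw [map_mul, hdet1, eval_C, one_mul]
      exact Nat.cast_ne_zero.mpr (NeZero.ne δ)
    · rw [map_mul, hdet, aeval_C, map_natCast]
      linear_combination htr
  have hΦM : ∀ j, Φ (X j - C (ξ j)) = paramMatrixAt α y j := by
    intro j
    rw [map_sub, hΦ, hz, ← algebraMap_eq, AlgHom.commutes, Algebra.algebraMap_eq_smul_one (A := R),
      smul_assoc, one_smul, Algebra.algebraMap_eq_smul_one, add_sub_cancel_left]
  -- the normal forms of the primal basis are the unit vectors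
  have hbasis : ∀ i, (Φ (shiftedMonomial ξ (α i))).mulVec e0 = Pi.single i 1 := by
    intro i
    -- Connectedness reaches `α i` from an earlier `α l`, and the prescribed entries `0` and `1` in
    -- column `l` of `M_j(μ)` send the unit vector `l` to the unit vector `i`.
    induction i using WellFoundedLT.induction with
    | ind i ih =>
      by_cases hi : α i = 0
      · have : i = 0 := h.injective (hi.trans h.exponent_zero.symm)
        rw [hi, shiftedMonomial_zero, map_one, Matrix.one_mulVec, this]
      · obtain ⟨l, j, hl⟩ := h.connected i hi
        have hli := h.lt_of_eq_add_single hl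
        rw [hl, shiftedMonomial_add_single, map_mul, ← Matrix.mulVec_mulVec, ih l hli, hΦM,
          paramMatrixAt_mulVec_single h.injective y j hli hl]
  have hMD : ∀ j i k, paramMatrixAt α y j i k = algebraMap ℂ R (dualMatrix ξ α Λ j i k) := by
    intro j i k
    have h1 := hred (shiftedMonomial ξ (α k + Finsupp.single j 1))
    rw [shiftedMonomial_add_single, map_mul, ← Matrix.mulVec_mulVec, hbasis, hΦM,
      Matrix.mulVec_single_one, ← shiftedMonomial_add_single] at h1
    have h2 := congrFun h1 i
    simpa [hbasis, Pi.single_apply, dualMatrix, Algebra.algebraMap_eq_smul_one] using h2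
  rcases s with j | ⟨⟨i, β⟩, hβ, k, hk, j, hj⟩
  · exact hz j
  · dsimp only at hβ hk hj
    subst hj
    have h1 := hMD j i k
    -- As `α k + e_j ∉ E`, this entry is the parameter itself.
    rw [paramMatrixAt, Matrix.of_apply, dif_pos hk, if_neg fun e => hβ ⟨i, e⟩, dif_neg hβ] at h1
    exact h1

end Uniqueness

/-! ### Simple roots -/

section SimpleRoot

variable {K σ ι : Type*} [Field K] [Algebra K ℂ] {P : ι → MvPolynomial σ K} {x : σ → ℂ}

theorem eval_eq_zero_of_mem_systemIdeal (hroot : ∀ k, aeval x (P k) = 0) {q : MvPolynomial σ ℂ}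
    (hq : q ∈ systemIdeal P) : eval x q = 0 := by
  suffices h : systemIdeal P ≤ RingHom.ker (eval x) from h hq
  refine Ideal.span_le.mpr ?_
  rintro _ ⟨k, rfl⟩
  change eval x _ = 0
  rw [← aeval_eq_eval, aeval_map_algebraMap, hroot]

/-- Some `p s` nonzero at `x` has `p s * (X s - C (x s))` in the ideal; on the neighbourhood where
no `p s` vanishes, a root must equal `x`. -/
theorem isIsolatedRoot_of_X_sub_C_mem [Finite σ] (hroot : ∀ k, aeval x (P k) = 0)
    (hx : ∀ s, X s - C (x s) ∈ primaryComponentAt (systemIdeal P) x) : IsIsolatedRoot P x := by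
  refine ⟨hroot, ?_⟩
  choose p hp hpX using hx
  have hnear : ∀ᶠ y in 𝓝 x, ∀ s, eval y (p s) ≠ 0 :=
    eventually_all.mpr fun s => ((p s).continuous_eval.continuousAt).eventually_ne (hp s)
  filter_upwards [nhdsWithin_le_nhds hnear, self_mem_nhdsWithin] with y hy hyx
  by_contra! hall
  refine hyx (funext fun s => ?_)
  have h := eval_eq_zero_of_mem_systemIdeal hall (hpX s)
  rw [map_mul, map_sub, eval_X, eval_C] at h
  exact sub_eq_zero.mp ((mul_eq_zero.mp h).resolve_left (hy s))

theorem multiplicityAt_eq_one_of_X_sub_C_mem (hroot : ∀ k, aeval x (P k) = 0)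
    (hx : ∀ s, X s - C (x s) ∈ primaryComponentAt (systemIdeal P) x) : multiplicityAt P x = 1 := by
  have hker : primaryComponentAt (systemIdeal P) x = RingHom.ker (aeval (R := ℂ) x) := by
    refine le_antisymm ?_ fun q hq => ?_
    · rintro q ⟨p, hp, hpq⟩
      have h := eval_eq_zero_of_mem_systemIdeal hroot hpq
      rw [map_mul] at h
      rw [RingHom.mem_ker, aeval_eq_eval]
      exact (mul_eq_zero.mp h).resolve_left hp
    · rw [RingHom.mem_ker, aeval_eq_eval] at hq
      rw [← Ideal.Quotient.eq_zero_iff_mem]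
      -- Modulo the component each coordinate is constant, so the quotient map is evaluation at `x`.
      have h : Ideal.Quotient.mkₐ ℂ (primaryComponentAt (systemIdeal P) x) =
          (Algebra.ofId ℂ _).comp (aeval (R := ℂ) x) := by
        ext s
        rw [AlgHom.comp_apply, aeval_X, Ideal.Quotient.mkₐ_eq_mk]
        exact (Ideal.Quotient.eq.mpr (hx s))
      have h1 := AlgHom.congr_fun h q
      rw [AlgHom.comp_apply, aeval_eq_eval, hq, map_zero] at h1
      exact h1
  have hsurj : Function.Surjective (aeval (R := ℂ) x) := fun c => ⟨C c, by simp⟩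
  rw [multiplicityAt, hker, (Ideal.quotientKerAlgEquivOfSurjective hsurj).toLinearEquiv.finrank_eq,
    Module.finrank_self]

/-- The directional derivative along `v` at `x` kills the generators, hence the whole ideal because
the ideal vanishes at `x`. On `p * (X t - C (x t))` it equals `p(x) v_t`. -/
theorem eq_zero_of_jacobianAt_mulVec_eq_zero [Fintype σ] (hroot : ∀ k, aeval x (P k) = 0)
    (hx : ∀ s, X s - C (x s) ∈ primaryComponentAt (systemIdeal P) x) (v : σ → ℂ)
    (hv : (jacobianAt P x).mulVec v = 0) : v = 0 := by
  classical
  have hD : ∀ q ∈ systemIdeal P, ∑ s, eval x (pderiv s q) * v s = 0 := by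
    intro q hq
    induction hq using Submodule.span_induction with
    | mem q hq =>
      obtain ⟨k, rfl⟩ := hq
      refine (Finset.sum_congr rfl fun s _ => ?_).trans (congrFun hv k)
      rw [pderiv_map, ← aeval_eq_eval, aeval_map_algebraMap]
      rfl
    | zero => simp
    | add p q _ _ hp hq => simp [add_mul, Finset.sum_add_distrib, hp, hq]
    | smul a q hq' hq =>
      have h0 := eval_eq_zero_of_mem_systemIdeal hroot hq'
      simp [h0, mul_assoc, ← Finset.mul_sum, hq]
  funext t
  obtain ⟨p, hp, hpX⟩ := hx t
  have h := hD _ hpX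
  rw [Finset.sum_eq_single t] at h
  · simpa [pderiv_mul, hp] using h
  · intro s _ hs
    simp [pderiv_X_of_ne (Ne.symm hs)]
  · simp

end SimpleRoot

/-! ### The tautological solution and the main theorem -/

theorem IsPrimalDualPair.X_sub_C_mem {K : Type*} [Field K] [Algebra K ℂ] {n N δ : ℕ} [NeZero δ]
    {f : Fin N → MvPolynomial (Fin n) K} {ξ : Fin n → ℂ} {α : Fin δ → Fin n →₀ ℕ}
    {Λ : Fin δ → MvPolynomial (Fin n) ℂ} (h : IsPrimalDualPair (systemIdeal f) ξ α Λ)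
    (s : Fin n ⊕ Param α) :
    X s - C (Sum.elim ξ (dualParam ξ α Λ) s) ∈
      primaryComponentAt (systemIdeal (deflatedSystem α f)) (Sum.elim ξ (dualParam ξ α Λ)) := by
  set x := Sum.elim ξ (dualParam ξ α Λ)
  set Q := primaryComponentAt (systemIdeal (deflatedSystem α f)) x with hQ
  have hmk : ∀ g, aeval (fun s => Ideal.Quotient.mk Q (X s)) g = Ideal.Quotient.mk Q g := by
    intro g
    have : aeval (fun s => Ideal.Quotient.mk Q (X s)) = Ideal.Quotient.mkₐ ℂ Q := by
      ext s; simp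
    rw [this]; rfl
  -- Uniqueness applied to the classes of the coordinates. A multiplier `g` with `g(x) ≠ 0` is
  -- regular modulo `Q`, since it can be absorbed into the multiplier `p` witnessing membership.
  have key := h.eq_of_deflatedSystem_eq_zero (y := fun s => Ideal.Quotient.mk Q (X s)) ?_ ?_ s
  · exact Ideal.Quotient.eq.mp key
  · intro g hg r hr
    obtain ⟨r, rfl⟩ := Ideal.Quotient.mk_surjective r
    rw [hmk, ← map_mul, Ideal.Quotient.eq_zero_iff_mem] at hr
    obtain ⟨p, hp, hpg⟩ := hr
    exact Ideal.Quotient.eq_zero_iff_mem.mpr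
      ⟨p * g, by rw [map_mul]; exact mul_ne_zero hp hg, by rwa [mul_assoc]⟩
  · intro e
    rw [← aeval_map_algebraMap ℂ, hmk, Ideal.Quotient.eq_zero_iff_mem]
    exact ⟨1, by simp, by rw [one_mul]; exact Ideal.subset_span ⟨e, rfl⟩⟩

end

end MultStructure

open MultStructure
theorem mainTheorem4 (K : Subfield ℂ) {n N δ : ℕ} [NeZero δ]
    (f : Fin N → MvPolynomial (Fin n) K) (ξ : Fin n → ℂ) (hξ : IsIsolatedRoot f ξ)
    (α : Fin δ → Fin n →₀ ℕ) (Λ : Fin δ → MvPolynomial (Fin n) ℂ)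
    (hB : IsPrimalDualPair (systemIdeal f) ξ α Λ) :
    IsIsolatedRoot (deflatedSystem α f) (Sum.elim ξ (dualParam ξ α Λ)) ∧
    multiplicityAt (deflatedSystem α f) (Sum.elim ξ (dualParam ξ α Λ)) = 1 ∧
    (∀ v : Fin n ⊕ Param α → ℂ,
      (jacobianAt (deflatedSystem α f) (Sum.elim ξ (dualParam ξ α Λ))).mulVec v = 0 → v = 0) ∧
    (∀ (p : MvPolynomial (Fin n) ℂ) (i : Fin δ),
      MvPolynomial.eval (Sum.elim ξ (dualParam ξ α Λ)) (paramNormalForm α p i) =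
        applyAt ξ (Λ i) p) := by
  have hroot := hB.aeval_deflatedSystem
  have hx := hB.X_sub_C_mem
  refine ⟨isIsolatedRoot_of_X_sub_C_mem hroot hx, multiplicityAt_eq_one_of_X_sub_C_mem hroot hx,
    eq_zero_of_jacobianAt_mulVec_eq_zero hroot hx, fun p i => ?_⟩
  rw [← aeval_eq_eval, hB.aeval_paramNormalForm_dualParam, Algebra.algebraMap_self,
    MvPolynomial.map_id]
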